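/- For a connected undirected graph $G$ on $n$ vertices (possibly with loops) with adjacency matrix $A$ and no zero row sum, let $D$ be the diagonal matrix of the row sums of $A$ (a loop contributes $1$) and $P=D^{-1}A$. Kemeny's constant of $G$ is $$\kappa(G)=\operatorname{trace}\bigl((I-P+\mathbf 1 v^{\top})^{-1}\bigr)-1,$$ where $v\in\mathbb R^n$ is any vector with $v^{\top}\mathbf 1=1$ (the inverse exists, and the value is the same for every such $v$). Let $p,q,r\ge 0$ be integers with $s=p+q+r\ge 1$. Let $E_{p,q,r}$ be the tree on the vertices $1,\dots,s+1$ formed by three paths (branches) with $p$, $q$ and $r$ edges that share only the root $1$: going outwards from the root, the further vertices of the branches are $2,\dots,p+1$; $\;p+2,\dots,p+q+1$; and $p+q+2,\dots,p+q+r+1$. Let $E_{p,q,r,p+1}$ be the graph obtained from $E_{p,q,r}$ by adding a loop at the vertex $p+1$, the end of the first branch (the root if $p=0$). Then $$\kappa(E_{p,q,r})=\frac{2s^2+1}{6}-\frac{2pqr}{s},\qquad \kappa(E_{p,q,r,p+1})=\frac{s(s+1)}{3}-2qr\,\frac{2p+1}{2s+1}.$$ -/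

import Mathlib

/-- The tree `E_{p,q,r}`: three branches with `p`, `q` and `r` edges glued at a root.
The vertex with the label `k` (`1 ≤ k ≤ p + q + r + 1`) is the element `k - 1` of
`Fin (p + q + r + 1)`: the root is `0`, and the branches are the consecutive blocks
`1, …, p`, then `p + 1, …, p + q`, then `p + q + 1, …, p + q + r`, each listed from the root
outwards. So `i` is joined to `i + 1` unless `i + 1` is the first vertex of the second or of the
third block, and these first vertices are joined to the root. -/
def threeBranchTree (p q r : ℕ) : SimpleGraph (Fin (p + q + r + 1)) :=
  SimpleGraph.fromRel fun i j =>
    ((j : ℕ) = i + 1 ∧ (j : ℕ) ≠ p + 1 ∧ (j : ℕ) ≠ p + q + 1) ∨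
      ((i : ℕ) = 0 ∧ ((j : ℕ) = p + 1 ∨ (j : ℕ) = p + q + 1))

open Classical in
/-- The adjacency matrix of `E_{p,q,r}`. -/
noncomputable def threeBranchAdj (p q r : ℕ) :
    Matrix (Fin (p + q + r + 1)) (Fin (p + q + r + 1)) ℝ :=
  (threeBranchTree p q r).adjMatrix ℝ

/-- The adjacency matrix of `E_{p,q,r,k}`, i.e. of `E_{p,q,r}` with a loop (of weight one) added
at the vertex `k`. -/
noncomputable def threeBranchLoopAdj (p q r : ℕ) (k : Fin (p + q + r + 1)) :
    Matrix (Fin (p + q + r + 1)) (Fin (p + q + r + 1)) ℝ :=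
  threeBranchAdj p q r + Matrix.single k k 1

/-- The stochastic matrix `P = D⁻¹ A` of the random walk on the (weighted) graph with adjacency
matrix `A`, where `D` is the diagonal matrix of the row sums of `A`. -/
noncomputable def transitionMatrix {n : Type*} [Fintype n] [DecidableEq n] (A : Matrix n n ℝ) :
    Matrix n n ℝ :=
  Matrix.diagonal (fun i => (∑ j, A i j)⁻¹) * A

/-- The graph with adjacency matrix `A` has Kemeny's constant `κ`: for `P = D⁻¹ A` and every vector
`v` with `vᵀ 1 = 1`, the matrix `I - P + 1 vᵀ` is invertible and
`κ = trace ((I - P + 1 vᵀ)⁻¹) - 1`. -/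
def HasKemenyConstant {n : Type*} [Fintype n] [DecidableEq n] (A : Matrix n n ℝ) (κ : ℝ) : Prop :=
  ∀ v : n → ℝ, ∑ i, v i = 1 →
    IsUnit (1 - transitionMatrix A + Matrix.vecMulVec (fun _ => 1) v) ∧
      κ = ((1 - transitionMatrix A + Matrix.vecMulVec (fun _ => 1) v)⁻¹).trace - 1

/-! With `π = d / σ`, where `σ` is the total degree, Kemeny's constant is half the mean of `R i j`
over independent `π`-random vertices, times `σ`; for a tree `R` is the distance. Distance counts
separating edges, so each edge contributes `w (σ - w) / σ`, where `w` is the degree sum on its far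
side (`sum_mul_cut`). Loops leave the Laplacian, hence `R`, unchanged and enter only through the
degrees. On a branch the values `w` form an arithmetic progression, summed in
`sum_range_odd_mul_sub`; loop weights `0` and `1` give the two formulas. -/

/-! ### Kemeny's constant from a Laplacian identity. -/

/-- If the Laplacian `D - A` sends a matrix `R` with zero diagonal to `τ 1ᵀ - 2 I`, then Kemeny's
constant is `dᵀ R d / (2 ∑ d)`, where `d` is the vector of row sums. -/
theorem hasKemenyConstant_of_laplacian_mul {n : Type*} [Fintype n] [DecidableEq n]
    {A R : Matrix n n ℝ} {d τ : n → ℝ} (hd : ∀ i, d i ≠ 0) (hA : ∀ i, ∑ j, A i j = d i)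
    (hσ : ∑ i, d i ≠ 0) (hR : ∀ i, R i i = 0)
    (hL : ∀ i j, d i * R i j - ∑ k, A i k * R k j = τ i - 2 * (if i = j then 1 else 0)) :
    HasKemenyConstant A ((∑ i, ∑ j, d i * d j * R i j) / (2 * ∑ i, d i)) := by
  intro v hv
  set σ := ∑ i, d i with hσd
  set g : n → ℝ := fun k => ∑ l, d l * R k l with hg
  -- `Z` solves `(I - P) Z = I - 1 πᵀ` and has zero row sums.
  set Z : n → n → ℝ := fun k j => d j * (g k / (2 * σ) - R k j / 2) with hZ
  -- `I - P` kills `1 uᵀ`, so `u` is free to be chosen with `vᵀ X = πᵀ`; the two copies of `1 πᵀ`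
  -- then cancel.
  set u : n → ℝ := fun j => d j / σ - ∑ k, v k * Z k j with hu
  set X : Matrix n n ℝ := Matrix.of fun k j => Z k j + u j with hX
  have hAR (i j) : ∑ k, A i k * R k j = d i * R i j - τ i + 2 * (if i = j then 1 else 0) := by
    linarith [hL i j]
  have hAg (i) : ∑ k, A i k * g k = d i * g i - σ * τ i + 2 * d i := by
    have : ∑ k, A i k * g k = ∑ l, d l * ∑ k, A i k * R k l := by
      simp only [hg, Finset.mul_sum]
      rw [Finset.sum_comm]
      exact Finset.sum_congr rfl fun _ _ => Finset.sum_congr rfl fun _ _ => by ring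
    rw [this]
    simp only [hAR, mul_add, mul_sub, Finset.sum_add_distrib, Finset.sum_sub_distrib,
      ← Finset.sum_mul, ← hσd]
    simp only [hg, Finset.mul_sum]
    congr 1
    · congr 1
      exact Finset.sum_congr rfl fun _ _ => by ring
    · simp [mul_comm]
  have hAZ (i j) : ∑ k, A i k * Z k j
      = d i * Z i j + d j * d i / σ - d j * (if i = j then 1 else 0) := by
    have : ∑ k, A i k * Z k j
        = d j * ((∑ k, A i k * g k) / (2 * σ) - (∑ k, A i k * R k j) / 2) := by
      simp only [hZ, Finset.sum_div, Finset.mul_sum, ← Finset.sum_sub_distrib]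
      exact Finset.sum_congr rfl fun _ _ => by ring
    rw [this, hAg, hAR]
    simp only [hZ]
    field_simp
    ring
  have hPX (i j) : ∑ k, transitionMatrix A i k * X k j
      = X i j + d j / σ - (if i = j then 1 else 0) := by
    have : ∑ k, transitionMatrix A i k * X k j
        = (d i)⁻¹ * (∑ k, A i k * Z k j + (∑ k, A i k) * u j) := by
      rw [Finset.sum_mul, ← Finset.sum_add_distrib, Finset.mul_sum]
      simp only [transitionMatrix, Matrix.diagonal_mul, hA, hX, Matrix.of_apply]
      exact Finset.sum_congr rfl fun _ _ => by ring
    rw [this, hAZ, hA]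
    simp only [hX, Matrix.of_apply]
    have := hd i
    split_ifs with h
    · subst h; field_simp; ring
    · field_simp; ring
  have hvX (j) : ∑ k, v k * X k j = d j / σ := by
    simp only [hX, Matrix.of_apply, mul_add, Finset.sum_add_distrib, ← Finset.sum_mul, hv, hu]
    ring
  have hinv : (1 - transitionMatrix A + Matrix.vecMulVec (fun _ => 1) v) * X = 1 := by
    ext i j
    have h1 : (Matrix.vecMulVec (fun _ => 1) v * X) i j = ∑ k, v k * X k j := by
      simp [Matrix.mul_apply, Matrix.vecMulVec_apply]
    rw [add_mul, sub_mul, one_mul, Matrix.add_apply, Matrix.sub_apply, h1, hvX,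
      Matrix.mul_apply, hPX, Matrix.one_apply]
    ring
  refine ⟨IsUnit.of_mul_eq_one _ hinv, ?_⟩
  rw [Matrix.inv_eq_right_inv hinv]
  have hZ1 (k) : ∑ j, Z k j = 0 := by
    have : ∑ j, Z k j = σ * (g k / (2 * σ)) - g k / 2 := by
      simp only [hZ, hσd, hg, mul_sub, Finset.sum_sub_distrib, ← Finset.sum_mul, Finset.sum_div]
      congr 1
      exact Finset.sum_congr rfl fun _ _ => by ring
    rw [this]; field_simp; ring
  have hsu : ∑ j, u j = 1 := by
    simp only [hu, Finset.sum_sub_distrib, ← Finset.sum_div, ← hσd]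
    rw [Finset.sum_comm]
    simp [← Finset.mul_sum, hZ1, hσ]
  have htr : X.trace = ∑ i, Z i i + 1 := by
    simp [Matrix.trace, hX, Finset.sum_add_distrib, hsu]
  rw [htr]
  rw [add_sub_cancel_right, Finset.sum_div]
  refine Finset.sum_congr rfl fun i _ => ?_
  simp only [hZ, hR, hg, mul_assoc, ← Finset.mul_sum]
  ring

/-! ### Rooted trees: distances as sums over cuts. -/

/-- For a 0/1-valued `χ e` the summand indicates that the cut `e` separates `i` from `j`; ordered
pairs give the factor 2. -/
theorem sum_mul_cut {n : Type*} [Fintype n] (d : n → ℝ) (χ : n → n → ℝ) :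
    ∑ i, ∑ j, d i * d j * ∑ e, (χ e i + χ e j - 2 * (χ e i * χ e j)) =
      2 * ∑ e, (∑ i, d i * χ e i) * (∑ i, d i - ∑ i, d i * χ e i) := by
  have h1 (e i) : ∑ j, d i * d j * (χ e i + χ e j - 2 * (χ e i * χ e j)) =
      d i * χ e i * ∑ j, d j + d i * ∑ j, d j * χ e j - 2 * (d i * χ e i) * ∑ j, d j * χ e j := by
    simp only [Finset.mul_sum, ← Finset.sum_add_distrib, ← Finset.sum_sub_distrib]
    exact Finset.sum_congr rfl fun _ _ => by ring
  have h2 (e) : ∑ i, ∑ j, d i * d j * (χ e i + χ e j - 2 * (χ e i * χ e j)) =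
      2 * ((∑ i, d i * χ e i) * (∑ i, d i - ∑ i, d i * χ e i)) := by
    simp only [h1, Finset.sum_add_distrib, Finset.sum_sub_distrib, ← Finset.sum_mul,
      ← Finset.mul_sum]
    ring
  rw [Finset.mul_sum, ← Finset.sum_congr rfl fun e _ => h2 e]
  refine (Finset.sum_comm.trans (Finset.sum_congr rfl fun i _ => ?_)).symm
  refine Finset.sum_comm.trans (Finset.sum_congr rfl fun j _ => ?_)
  exact (Finset.mul_sum ..).symm

/-- A tree with root `o`, given by its parent map and the indicators `χ e` of the subtrees of
descendants, with loops of weights `c`. -/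
theorem hasKemenyConstant_rootedTree {n : Type*} [Fintype n] [DecidableEq n]
    {A : Matrix n n ℝ} {c : n → ℝ} {o : n} {par : n → n} {χ : n → n → ℝ}
    (hA : ∀ i j, A i j = (if i ≠ o ∧ j = par i then 1 else 0) +
      (if j ≠ o ∧ i = par j then 1 else 0) + (if i = j then c i else 0))
    (hχ1 : ∀ i, χ o i = 1) (hχo : ∀ e, χ e o = if e = o then 1 else 0)
    (hχ : ∀ e f, f ≠ o → χ e f = χ e (par f) + if e = f then 1 else 0)
    (hχχ : ∀ e i, χ e i * χ e i = χ e i)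
    (hd : ∀ i, ∑ j, A i j ≠ 0) (hσ : ∑ i, ∑ j, A i j ≠ 0) :
    HasKemenyConstant A ((∑ e, (∑ i, (∑ j, A i j) * χ e i) *
      (∑ i, ∑ j, A i j - ∑ i, (∑ j, A i j) * χ e i)) / ∑ i, ∑ j, A i j) := by
  -- Column `e ≠ o` is the signed incidence vector of the edge from `e` to its parent. The recursion
  -- for `χ` says that `χ` is a left inverse, hence a two-sided one.
  set B : Matrix n n ℝ := Matrix.of fun i e => (if i = e then 1 else 0) -
    (if e ≠ o ∧ i = par e then 1 else 0) with hB
  have hχB : Matrix.of χ * B = 1 := by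
    ext e f
    simp only [Matrix.mul_apply, hB, Matrix.of_apply, mul_sub, Finset.sum_sub_distrib,
      Matrix.one_apply]
    by_cases hf : f = o
    · simp [hf, hχo]
    · simp [hf, hχ e f hf]
  have hBχ (i j) : ∑ e, B i e * χ e j = if i = j then 1 else 0 := by
    have h := mul_eq_one_comm.mp hχB
    have := congrFun (congrFun h i) j
    simpa [Matrix.mul_apply, Matrix.one_apply] using this
  -- The Laplacian of `χ e` lives on the two ends of the edge `e`. It vanishes for the constant `χ
  -- o`, whence the correction at the root.
  have hAχ (i e) : ∑ k, A i k * (χ e i - χ e k) = B i e - if i = o ∧ e = o then 1 else 0 := by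
    have h1 (k) : A i k * (χ e i - χ e k) =
        (if i ≠ o ∧ k = par i then χ e i - χ e (par i) else 0) -
        (if k ≠ o ∧ i = par k then χ e k - χ e (par k) else 0) := by
      rw [hA]
      have h₁ : (if i ≠ o ∧ k = par i then (1 : ℝ) else 0) * (χ e i - χ e k) =
          if i ≠ o ∧ k = par i then χ e i - χ e (par i) else 0 := by
        split_ifs with h
        · rw [h.2, one_mul]
        · rw [zero_mul]
      have h₂ : (if k ≠ o ∧ i = par k then (1 : ℝ) else 0) * (χ e i - χ e k) =
          -if k ≠ o ∧ i = par k then χ e k - χ e (par k) else 0 := by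
        split_ifs with h
        · rw [← h.2]; ring
        · simp
      have h₃ : (if i = k then c i else 0) * (χ e i - χ e k) = 0 := by
        split_ifs with h
        · rw [h]; ring
        · rw [zero_mul]
      rw [add_mul, add_mul, h₁, h₂, h₃]
      ring
    have h2 (k) : (if k ≠ o ∧ i = par k then χ e k - χ e (par k) else 0) =
        if e = k then (if e ≠ o ∧ i = par e then (1 : ℝ) else 0) else 0 := by
      by_cases hk : k = o
      · grind
      · rw [hχ e k hk]; grind
    simp only [h1, h2, Finset.sum_sub_distrib, Finset.sum_ite_eq, Finset.mem_univ, if_true, hB,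
      Matrix.of_apply]
    by_cases hi : i = o
    · by_cases he : e = o
      · simp [hi, he]
      · simp [hi, he, Ne.symm he]
    · simp only [hχ e i hi, ne_eq, hi, not_false_eq_true, true_and, false_and, if_false,
        Finset.sum_ite_eq', Finset.mem_univ, if_true, sub_zero, add_sub_cancel_left]
      exact congrArg (· - _) (if_congr eq_comm rfl rfl)

  -- The tree distance; the term `e = o` is zero.
  set R : Matrix n n ℝ := Matrix.of fun i j => ∑ e, (χ e i + χ e j - 2 * (χ e i * χ e j)) with hR
  have hL (i j) : (∑ k, A i k) * R i j - ∑ k, A i k * R k j =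
      ∑ e, (B i e - if i = o ∧ e = o then 1 else 0) + (if i = o then 2 else 0) -
        2 * (if i = j then 1 else 0) := by
    have h1 : (∑ k, A i k) * R i j - ∑ k, A i k * R k j =
        ∑ e, (∑ k, A i k * (χ e i - χ e k)) * (1 - 2 * χ e j) := by
      simp only [Finset.sum_mul, ← Finset.sum_sub_distrib, hR, Matrix.of_apply]
      rw [Finset.sum_comm]
      refine Finset.sum_congr rfl fun k _ => ?_
      rw [← mul_sub, ← Finset.sum_sub_distrib, Finset.mul_sum]
      exact Finset.sum_congr rfl fun _ _ => by ring
    have h2 : ∑ e, (if i = o ∧ e = o then (1 : ℝ) else 0) * (2 * χ e j) =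
        if i = o then 2 else 0 := by
      by_cases hi : i = o <;> simp [hi, hχ1]
    have h3 : ∑ e, B i e * (2 * χ e j) = 2 * ∑ e, B i e * χ e j := by
      rw [Finset.mul_sum]
      exact Finset.sum_congr rfl fun _ _ => by ring
    rw [h1, ← hBχ i j]
    simp only [hAχ]
    simp only [mul_sub, mul_one, Finset.sum_sub_distrib, sub_mul, h2, h3]
    ring
  have hR0 (i) : R i i = 0 := by
    simp only [hR, Matrix.of_apply, hχχ]
    exact Finset.sum_eq_zero fun _ _ => by ring
  have key := hasKemenyConstant_of_laplacian_mul hd (fun _ => rfl) hσ hR0 hL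
  convert key using 1
  have h4 : ∑ i, ∑ j, (∑ k, A i k) * (∑ k, A j k) * R i j =
      2 * ∑ e, (∑ i, (∑ j, A i j) * χ e i) *
        (∑ i, ∑ j, A i j - ∑ i, (∑ j, A i j) * χ e i) := by
    simpa only [hR, Matrix.of_apply] using sum_mul_cut (fun i => ∑ k, A i k) χ
  rw [h4, mul_div_mul_left _ _ two_ne_zero]

/-- Kemeny's constant of a rooted tree with loops of weights `c`: the vertex `e ≠ o` stands for the
edge to its parent, and `w e` is the sum of the degrees below this edge. -/
theorem hasKemenyConstant_rootedTree_of_weights {n : Type*} [Fintype n] [DecidableEq n]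
    {A : Matrix n n ℝ} {c w : n → ℝ} {o : n} {par : n → n} {χ : n → n → ℝ}
    (hA : ∀ i j, A i j = (if i ≠ o ∧ j = par i then 1 else 0) +
      (if j ≠ o ∧ i = par j then 1 else 0) + (if i = j then c i else 0))
    (hχ1 : ∀ i, χ o i = 1) (hχo : ∀ e, χ e o = if e = o then 1 else 0)
    (hχ : ∀ e f, f ≠ o → χ e f = χ e (par f) + if e = f then 1 else 0)
    (hχχ : ∀ e i, χ e i * χ e i = χ e i)
    (hc : ∀ i, 0 ≤ c i) (ho : ∃ f, f ≠ o ∧ o = par f)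
    (hw : ∀ e, e ≠ o → w e = 2 * ∑ f, χ e f - 1 + ∑ f, c f * χ e f) {σ : ℝ}
    (hσ : σ = 2 * (Fintype.card n - 1) + ∑ f, c f) :
    HasKemenyConstant A ((∑ e, if e = o then 0 else w e * (σ - w e)) / σ) := by
  -- Degree sums are counted edge by edge: each edge contributes at both ends.
  have hdx (x : n → ℝ) : ∑ i, (∑ j, A i j) * x i =
      ∑ f, (if f ≠ o then x f + x (par f) else 0) + ∑ f, c f * x f := by
    have h1 : ∑ i, ∑ j, (if j ≠ o ∧ i = par j then (1 : ℝ) else 0) * x i =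
        ∑ f, if f ≠ o then x (par f) else 0 := by
      rw [Finset.sum_comm]
      refine Finset.sum_congr rfl fun f _ => ?_
      by_cases hf : f = o <;> simp [hf]
    have h2 : ∑ i, ∑ j, (if i ≠ o ∧ j = par i then (1 : ℝ) else 0) * x i =
        ∑ f, if f ≠ o then x f else 0 := by
      refine Finset.sum_congr rfl fun f _ => ?_
      by_cases hf : f = o <;> simp [hf]
    have h3 : ∑ i, ∑ j, (if i = j then c i else 0) * x i = ∑ f, c f * x f := by
      simp
    simp only [Finset.sum_mul, hA, add_mul, Finset.sum_add_distrib, h1, h2, h3]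
    rw [← Finset.sum_add_distrib]
    congr 1
    exact Finset.sum_congr rfl fun f _ => by split_ifs <;> simp
  have hnn (i j) : 0 ≤ A i j := by
    rw [hA]
    have := hc i
    split_ifs <;> linarith
  have hd (i) : 0 < ∑ j, A i j := by
    have key : ∃ j, 0 < A i j := by
      by_cases hi : i = o
      · obtain ⟨f, hf, hof⟩ := ho
        refine ⟨f, ?_⟩
        have h : f ≠ o ∧ i = par f := ⟨hf, hi.trans hof⟩
        rw [hA, if_pos h]
        have := hc i
        split_ifs <;> linarith
      · refine ⟨par i, ?_⟩
        have h : i ≠ o ∧ par i = par i := ⟨hi, rfl⟩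
        rw [hA, if_pos h]
        have := hc i
        split_ifs <;> linarith
    obtain ⟨j, hj⟩ := key
    exact Finset.sum_pos' (fun j _ => hnn i j) ⟨j, Finset.mem_univ j, hj⟩
  have hσ' : ∑ i, ∑ j, A i j = σ := by
    have h := hdx fun _ => 1
    simp only [mul_one] at h
    rw [h, hσ, ← Finset.sum_filter, Finset.sum_const, Finset.filter_ne',
      Finset.card_erase_of_mem (Finset.mem_univ o), Finset.card_univ, nsmul_eq_mul,
      Nat.cast_pred (Fintype.card_pos_iff.2 ⟨o⟩)]
    ring
  -- Only the edge from `e` to its parent has a single end below `e`, hence the `-1` in `w`.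
  have hD (e) (he : e ≠ o) : ∑ i, (∑ j, A i j) * χ e i = w e := by
    have h (f) : (if f ≠ o then χ e f + χ e (par f) else 0) =
        2 * χ e f - if e = f then 1 else 0 := by
      by_cases hf : f = o
      · simp [hf, hχo, he]
      · rw [if_pos hf, hχ e f hf]; ring
    rw [hdx, hw e he]
    simp only [h, Finset.sum_sub_distrib, ← Finset.mul_sum]
    simp
  have hσpos : 0 < ∑ i, ∑ j, A i j :=
    Finset.sum_pos (fun i _ => hd i) ⟨o, Finset.mem_univ o⟩
  have key := hasKemenyConstant_rootedTree hA hχ1 hχo hχ hχχ (fun i => (hd i).ne') hσpos.ne'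
  rw [hσ'] at key
  convert key using 3 with e
  split_ifs with he
  · simp [he, hχ1, hσ']
  · rw [hD e he]

/-! ### The three-branch tree. -/

/-- The contribution of a branch of `l` edges with a loop of weight `μ` at its end: beyond edge `k`
lie `l - 1 - k` further edges. The induction removes the edge at the root. -/
theorem sum_range_odd_mul_sub (σ μ : ℝ) (l : ℕ) :
    ∑ k ∈ Finset.range l, (2 * ((l : ℝ) - 1 - k) + 1 + μ) * (σ - (2 * ((l : ℝ) - 1 - k) + 1 + μ)) =
      σ * (l ^ 2 + μ * l) - (l * (4 * l ^ 2 - 1) / 3 + 2 * μ * l ^ 2 + μ ^ 2 * l) := by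
  induction l with
  | zero => simp
  | succ l ih =>
    rw [Finset.sum_range_succ']
    have h (k : ℕ) : ((l + 1 : ℕ) : ℝ) - 1 - ((k + 1 : ℕ) : ℝ) = (l : ℝ) - 1 - k := by
      push_cast; ring
    simp only [h, ih]
    push_cast
    ring

/-- The parent of a vertex of `E_{p,q,r}`. -/
def threeBranchParent (p q r : ℕ) (f : Fin (p + q + r + 1)) : Fin (p + q + r + 1) :=
  if (f : ℕ) = p + 1 ∨ (f : ℕ) = p + q + 1 then 0 else ⟨f - 1, by omega⟩

/-- The last vertex of the branch of a vertex of `E_{p,q,r}` (the last vertex for the root). -/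
def threeBranchEnd (p q r e : ℕ) : ℕ :=
  if e = 0 then p + q + r else if e ≤ p then p else if e ≤ p + q then p + q else p + q + r

/-- The indicator of the descendants of the vertex `e` of `E_{p,q,r}`. -/
noncomputable def threeBranchBelow (p q r : ℕ) (e f : ℕ) : ℝ :=
  if e ≤ f ∧ f ≤ threeBranchEnd p q r e then 1 else 0

theorem coe_threeBranchParent (p q r : ℕ) (f : Fin (p + q + r + 1)) :
    (threeBranchParent p q r f : ℕ) =
      if (f : ℕ) = p + 1 ∨ (f : ℕ) = p + q + 1 then 0 else (f : ℕ) - 1 := by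
  unfold threeBranchParent
  split_ifs <;> rfl

theorem threeBranchAdj_apply (p q r : ℕ) (i j : Fin (p + q + r + 1)) :
    threeBranchAdj p q r i j =
      (if i ≠ 0 ∧ j = threeBranchParent p q r i then 1 else 0) +
        (if j ≠ 0 ∧ i = threeBranchParent p q r j then 1 else 0) := by
  have h : (threeBranchTree p q r).Adj i j ↔
      (i ≠ 0 ∧ j = threeBranchParent p q r i) ∨ (j ≠ 0 ∧ i = threeBranchParent p q r j) := by
    simp only [threeBranchTree, SimpleGraph.fromRel_adj, ne_eq, Fin.ext_iff,
      coe_threeBranchParent, Fin.val_zero]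
    split_ifs <;> omega
  -- Parents of non-root vertices have smaller labels, so the two indicators never overlap.
  have h' : ¬((i ≠ 0 ∧ j = threeBranchParent p q r i) ∧
      (j ≠ 0 ∧ i = threeBranchParent p q r j)) := by
    simp only [ne_eq, Fin.ext_iff, coe_threeBranchParent, Fin.val_zero]
    split_ifs <;> omega
  rw [threeBranchAdj, SimpleGraph.adjMatrix_apply]
  simp only [h]
  by_cases h₁ : i ≠ 0 ∧ j = threeBranchParent p q r i <;>
    by_cases h₂ : j ≠ 0 ∧ i = threeBranchParent p q r j
  · exact absurd ⟨h₁, h₂⟩ h'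
  · rw [if_pos (Or.inl h₁), if_pos h₁, if_neg h₂, add_zero]
  · rw [if_pos (Or.inr h₂), if_neg h₁, if_pos h₂, zero_add]
  · rw [if_neg (not_or.2 ⟨h₁, h₂⟩), if_neg h₁, if_neg h₂, add_zero]

/-- Descendants form an interval of labels, which a step to the parent leaves only from its lower
end `e`. -/
theorem threeBranchBelow_parent (p q r : ℕ) (e f : Fin (p + q + r + 1)) (hf : f ≠ 0) :
    threeBranchBelow p q r e f = threeBranchBelow p q r e (threeBranchParent p q r f) +
      if e = f then 1 else 0 := by
  have hf' : (f : ℕ) ≠ 0 := fun h => hf (Fin.ext h)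
  have := e.2
  have := f.2
  simp only [threeBranchBelow, threeBranchEnd, coe_threeBranchParent, Fin.ext_iff]
  split_ifs <;> first | omega | norm_num

theorem sum_threeBranchBelow (p q r : ℕ) (e : Fin (p + q + r + 1)) :
    ∑ f : Fin (p + q + r + 1), threeBranchBelow p q r e f =
      (threeBranchEnd p q r e : ℝ) - e + 1 := by
  have he := e.2
  have hle : (e : ℕ) ≤ threeBranchEnd p q r e := by
    unfold threeBranchEnd; split_ifs <;> omega
  have hlt : threeBranchEnd p q r e < p + q + r + 1 := by
    unfold threeBranchEnd; split_ifs <;> omega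
  rw [Fin.sum_univ_eq_sum_range (fun f => threeBranchBelow p q r e f)]
  simp only [threeBranchBelow]
  rw [← Finset.sum_filter]
  have : (Finset.range (p + q + r + 1)).filter
      (fun f => (e : ℕ) ≤ f ∧ f ≤ threeBranchEnd p q r e) =
      Finset.Icc (e : ℕ) (threeBranchEnd p q r e) := by
    ext f
    simp only [Finset.mem_filter, Finset.mem_range, Finset.mem_Icc]
    omega
  rw [this, Finset.sum_const, Nat.card_Icc, nsmul_eq_mul, Nat.cast_sub (by omega)]
  push_cast
  ring

/-- Kemeny's constant of `E_{p,q,r}` with a loop of weight `t` at the end of the first branch. -/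
theorem hasKemenyConstant_threeBranch (p q r : ℕ) (hs : 0 < p + q + r) (t : ℝ) (ht : 0 ≤ t)
    (a : Fin (p + q + r + 1)) (ha : (a : ℕ) = p) {σ : ℝ} (hσ : σ = 2 * ((p : ℝ) + q + r) + t) :
    HasKemenyConstant (threeBranchAdj p q r + Matrix.single a a t)
      (((σ * ((p : ℝ) ^ 2 + t * p) - (p * (4 * p ^ 2 - 1) / 3 + 2 * t * p ^ 2 + t ^ 2 * p)) +
        (σ * (q : ℝ) ^ 2 - q * (4 * q ^ 2 - 1) / 3) +
        (σ * (r : ℝ) ^ 2 - r * (4 * r ^ 2 - 1) / 3)) / σ) := by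
  -- The loop lies below every edge of the first branch and below no other edge.
  set w : ℕ → ℝ := fun e =>
    2 * ((threeBranchEnd p q r e : ℝ) - e) + 1 + if e ≤ p then t else 0 with hw
  have key := hasKemenyConstant_rootedTree_of_weights
    (A := threeBranchAdj p q r + Matrix.single a a t) (c := fun i => if a = i then t else 0)
    (w := fun e => w e) (o := 0) (par := threeBranchParent p q r)
    (χ := fun e f => threeBranchBelow p q r e f) (σ := σ)
    (fun i j => by
      rw [Matrix.add_apply, threeBranchAdj_apply, Matrix.single_apply]
      congr 1
      grind)
    (fun i => by
      have := i.2
      simp only [threeBranchBelow, threeBranchEnd, Fin.val_zero, if_true]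
      exact if_pos (by omega))
    (fun e => by
      simp only [threeBranchBelow, threeBranchEnd, Fin.ext_iff, Fin.val_zero]
      split_ifs <;> first | rfl | omega)
    (fun e f hf => threeBranchBelow_parent p q r e f hf)
    (fun e i => by simp [threeBranchBelow])
    (fun i => by split_ifs <;> simp [ht])
    -- The vertex `1` is a child of the root whichever branches are empty.
    ⟨⟨1, by omega⟩, by simp [Fin.ext_iff], by
      simp only [Fin.ext_iff, coe_threeBranchParent, Fin.val_zero]
      split_ifs <;> rfl⟩
    (fun e he => by
      have he' : (e : ℕ) ≠ 0 := fun h => he (Fin.ext h)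
      have h : threeBranchBelow p q r e p = if (e : ℕ) ≤ p then 1 else 0 := by
        simp only [threeBranchBelow, threeBranchEnd]
        split_ifs <;> first | rfl | omega
      rw [sum_threeBranchBelow]
      simp only [ite_mul, zero_mul, Finset.sum_ite_eq, Finset.mem_univ, if_true, hw, ha, h,
        mul_ite, mul_one, mul_zero]
      ring)
    (by simp [hσ])
  convert key using 2
  have hF (e : Fin (p + q + r + 1)) : (if e = 0 then 0 else w e * (σ - w e)) =
      (fun k : ℕ => if k = 0 then 0 else w k * (σ - w k)) e := by
    simp only [Fin.ext_iff, Fin.val_zero]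
  rw [Finset.sum_congr rfl fun e _ => hF e,
    Fin.sum_univ_eq_sum_range (fun k : ℕ => if k = 0 then 0 else w k * (σ - w k)), Finset.sum_range_succ']
  simp only [Nat.add_eq_zero_iff, one_ne_zero, and_false, if_false, if_true, add_zero]
  -- With the root term split off, the edges fall into blocks of `p`, `q` and `r`.
  rw [Finset.sum_range_add, Finset.sum_range_add]
  congr 1
  · congr 1
    · rw [← sum_range_odd_mul_sub σ t p]
      refine Finset.sum_congr rfl fun k hk => ?_
      have hk := Finset.mem_range.1 hk
      have : w (k + 1) = 2 * ((p : ℝ) - 1 - k) + 1 + t := by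
        simp only [hw, threeBranchEnd]
        rw [if_neg (by omega), if_pos (by omega), if_pos (by omega)]
        push_cast; ring
      rw [this]
    · have h := sum_range_odd_mul_sub σ 0 q
      simp only [zero_mul, add_zero, mul_zero, ne_eq, OfNat.ofNat_ne_zero, not_false_eq_true,
        zero_pow] at h
      rw [← h]
      refine Finset.sum_congr rfl fun k hk => ?_
      have hk := Finset.mem_range.1 hk
      have : w (p + k + 1) = 2 * ((q : ℝ) - 1 - k) + 1 := by
        simp only [hw, threeBranchEnd]
        rw [if_neg (by omega), if_neg (by omega), if_pos (by omega), if_neg (by omega)]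
        push_cast; ring
      rw [this]
  · have h := sum_range_odd_mul_sub σ 0 r
    simp only [zero_mul, add_zero, mul_zero, ne_eq, OfNat.ofNat_ne_zero, not_false_eq_true,
      zero_pow] at h
    rw [← h]
    refine Finset.sum_congr rfl fun k hk => ?_
    have hk := Finset.mem_range.1 hk
    have : w (p + q + k + 1) = 2 * ((r : ℝ) - 1 - k) + 1 := by
      simp only [hw, threeBranchEnd]
      rw [if_neg (by omega), if_neg (by omega), if_neg (by omega), if_neg (by omega)]
      push_cast; ring
    rw [this]

theorem mainTheorem9 (p q r : ℕ) (hs : 0 < p + q + r) (s : ℝ) (hsum : s = (p : ℝ) + q + r) :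
    HasKemenyConstant (threeBranchAdj p q r)
        ((2 * s ^ 2 + 1) / 6 - 2 * (p : ℝ) * q * r / s) ∧
      HasKemenyConstant (threeBranchLoopAdj p q r ⟨p, by omega⟩)
        (s * (s + 1) / 3 - 2 * (q : ℝ) * r * (2 * p + 1) / (2 * s + 1)) := by
  have hs' : (0 : ℝ) < p + q + r := by exact_mod_cast hs
  constructor
  · have h := hasKemenyConstant_threeBranch p q r hs 0 le_rfl ⟨p, by omega⟩ rfl rfl
    rw [Matrix.single_zero, add_zero] at h
    convert h using 1
    rw [hsum]
    field_simp
    ring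
  · have h := hasKemenyConstant_threeBranch p q r hs 1 zero_le_one ⟨p, by omega⟩ rfl rfl
    rw [threeBranchLoopAdj]
    convert h using 1
    rw [hsum]
    have : (2 * ((p : ℝ) + q + r) + 1) ≠ 0 := by positivity
    field_simp
    ring
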